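/- Let $\Gamma$ be a countably infinite connected simple graph with symmetric edge weights $\mu_{x,y}=\mu_{y,x}$, where $\mu_{x,y}>0$ if $x\sim y$ and $\mu_{x,y}=0$ otherwise, such that $\mu(x)=\sum_{y\sim x}\mu_{x,y}<\infty$ for every vertex $x$. Put $\mu(A)=\sum_{y\in A}\mu(y)$ for $A\subset\Gamma$, $P(x,y)=\mu_{x,y}/\mu(x)$, $Pf(x)=\sum_yP(x,y)f(y)$, $\Delta=P-I$ and $(f,g)_\mu=\sum_x f(x)g(x)\mu(x)$. Let $d$ be the graph distance and, for real $R>0$, let $B(x,R)=\{y:d(x,y)<R\}$ and $V(x,R)=\mu(B(x,R))$. For $0<r<R$ let $v(x,r,R)=V(x,R)-V(x,r)$ and $\rho(x,r,R)=\rho(B(x,r),\Gamma\setminus B(x,R))$, where for disjoint $A,B\subset\Gamma$ $$\rho(A,B)=\Bigl(\inf\bigl\{(-\Delta f,f)_\mu : f \text{ finitely supported},\ f|_A=1,\ f|_B=0\bigr\}\Bigr)^{-1}.$$ Suppose that the following four conditions hold. - $(p_0)$: there is $p_0>0$ such that $\mu_{x,y}/\mu(x)\ge p_0$ for all $x\sim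 y$. - $(VD)$: there is $D_V>0$ such that $V(x,2R)\le D_V V(x,R)$ for all $x\in\Gamma$ and $R>0$. - $(H)$: there is $H>1$ such that for all $x\in\Gamma$, $R>0$ and every function $u\ge 0$ that is defined on $B(x,2R)$ and the neighbours of its vertices and satisfies $Pu=u$ on $B(x,2R)$, one has $\max_{B(x,R)}u\le H\min_{B(x,R)}u$. - $(\rho v)$: there is $C>1$ such that $C^{-1}\rho(x,R,2R)v(x,R,2R)\le\rho(y,R,2R)v(y,R,2R)\le C\rho(x,R,2R)v(x,R,2R)$ for all $x,y\in\Gamma$ and $R>0$. Then there is $A>1$ such that for all $x\in\Gamma$ and all $R>0$ $$\rho(x,AR,2AR)\,v(x,AR,2AR)\ \ge\ 2\,\rho(x,R,2R)\,v(x,R,2R).$$ -/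

import Mathlib

/-- A weighted graph on the vertex set `V`: a simple graph together with a symmetric weight
`μ_{x,y}` which is positive exactly on the edges, and whose sum around each vertex is finite. -/
structure WeightedGraph (V : Type*) where
  graph : SimpleGraph V
  weight : V → V → ℝ
  weight_symm : ∀ x y, weight x y = weight y x
  weight_pos : ∀ x y, graph.Adj x y → 0 < weight x y
  weight_eq_zero : ∀ x y, ¬ graph.Adj x y → weight x y = 0
  weight_summable : ∀ x, Summable (fun y => weight x y)

namespace WeightedGraph

noncomputable section

variable {V : Type*} (Γ : WeightedGraph V)

/-- `μ(x) = ∑_{y ∼ x} μ_{x,y}`. -/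
def vertexMeasure (x : V) : ℝ := ∑' y, Γ.weight x y

/-- `μ(A) = ∑_{y ∈ A} μ(y)`. -/
def setMeasure (A : Set V) : ℝ := ∑' y : A, Γ.vertexMeasure y

/-- Transition probability `P(x,y) = μ_{x,y} / μ(x)`. -/
def transition (x y : V) : ℝ := Γ.weight x y / Γ.vertexMeasure x

/-- Markov operator `P f(x) = ∑_y P(x,y) f(y)`. -/
def markov (f : V → ℝ) (x : V) : ℝ := ∑' y, Γ.transition x y * f y

/-- Laplace operator `Δ = P - I`. -/
def laplacian (f : V → ℝ) (x : V) : ℝ := Γ.markov f x - f x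

/-- `(f,g)_μ = ∑_x f(x) g(x) μ(x)`, used when one of the functions is finitely supported. -/
def innerMu (f g : V → ℝ) : ℝ := ∑' x, f x * g x * Γ.vertexMeasure x

/-- Open ball `B(x,R) = {y : d(x,y) < R}` for the graph distance. -/
def ball (x : V) (R : ℝ) : Set V := {y | (Γ.graph.dist x y : ℝ) < R}

/-- `V(x,R) = μ(B(x,R))`. -/
def volume (x : V) (R : ℝ) : ℝ := Γ.setMeasure (Γ.ball x R)

/-- Volume of the annulus, `v(x,r,R) = V(x,R) - V(x,r)`. -/
def annulusVolume (x : V) (r R : ℝ) : ℝ := Γ.volume x R - Γ.volume x r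

/-- Resistance between `A` and `B`: the inverse of the infimum of the Dirichlet form `(-Δf, f)_μ`
over the finitely supported `f` with `f = 1` on `A` and `f = 0` on `B`. -/
def resistance (A B : Set V) : ℝ :=
  (sInf {e : ℝ | ∃ f : V → ℝ, f.support.Finite ∧ (∀ x ∈ A, f x = 1) ∧ (∀ x ∈ B, f x = 0) ∧
    e = Γ.innerMu (fun x => - Γ.laplacian f x) f})⁻¹

/-- Resistance of the annulus, `ρ(x,r,R) = ρ(B(x,r), Γ \ B(x,R))`. -/
def annulusResistance (x : V) (r R : ℝ) : ℝ := Γ.resistance (Γ.ball x r) (Γ.ball x R)ᶜ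

/-- The product `ρ(x,R,2R) v(x,R,2R)`. -/
def rhoV (x : V) (R : ℝ) : ℝ :=
  Γ.annulusResistance x R (2 * R) * Γ.annulusVolume x R (2 * R)

/-- Condition `(p₀)`. -/
def CondP0 : Prop :=
  ∃ p₀ : ℝ, 0 < p₀ ∧ ∀ x y, Γ.graph.Adj x y → p₀ ≤ Γ.weight x y / Γ.vertexMeasure x

/-- Volume doubling `(VD)`. -/
def VolumeDoubling : Prop :=
  ∃ D : ℝ, 0 < D ∧ ∀ (x : V) (R : ℝ), 0 < R → Γ.volume x (2 * R) ≤ D * Γ.volume x R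

/-- The closure of `A`: the vertices of `A` and their neighbours. -/
def closure (A : Set V) : Set V := A ∪ {y | ∃ x ∈ A, Γ.graph.Adj x y}

/-- `h` is harmonic on `A`: `P h = h` on `A`. Only the values of `h` on the closure of `A`
matter. -/
def IsHarmonicOn (h : V → ℝ) (A : Set V) : Prop := ∀ x ∈ A, Γ.markov h x = h x

/-- The elliptic Harnack inequality `(H)`: `max_{B(x,R)} u ≤ H min_{B(x,R)} u` for every
nonnegative `u` harmonic in `B(x,2R)`. -/
def EllipticHarnack : Prop :=
  ∃ H : ℝ, 1 < H ∧ ∀ (x : V) (R : ℝ), 0 < R → ∀ u : V → ℝ,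
    (∀ y ∈ Γ.closure (Γ.ball x (2 * R)), 0 ≤ u y) →
    Γ.IsHarmonicOn u (Γ.ball x (2 * R)) →
    ∀ y ∈ Γ.ball x R, ∀ z ∈ Γ.ball x R, u y ≤ H * u z

/-- Condition `(ρv)`: `ρ(x,R,2R) v(x,R,2R) ≃ ρ(y,R,2R) v(y,R,2R)`, uniformly in `x`, `y`, `R`. -/
def CondRhoV : Prop :=
  ∃ C : ℝ, 1 < C ∧ ∀ (x y : V) (R : ℝ), 0 < R →
    C⁻¹ * Γ.rhoV x R ≤ Γ.rhoV y R ∧ Γ.rhoV y R ≤ C * Γ.rhoV x R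

end

end WeightedGraph

/- Capacities are subadditive and resistances add up in series. Covering `B(x,r)` by balls of
radius `R` whose halves are disjoint, subadditivity and `(VD)` bound the capacity of a shell
`B(x,r+2R) \ B(x,r)` by a multiple of `V(x,r+2R) / (ρv)(R)`, where `(ρv)` makes `(ρv)(R)`
comparable at all centres. For `T = 4kR` the annulus `B(x,2T) \ B(x,T)` contains `k` separated
shells of this kind, so in series they give `ρ(x,T,2T) ≥ c k (ρv)(R) / V(x,2T)`. By `(VD)` again,
`v(x,T,2T)` is comparable to `V(x,2T)`, hence `(ρv)(T) ≥ c' k (ρv)(R)` with `c'` independent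
of `k`. -/

namespace WeightedGraph

/-! ### Graph distance and balls -/

section Distance

variable {V : Type*} {G : SimpleGraph V}

lemma exists_dist_eq_and_dist_eq_sub {x z : V} {n : ℕ} (hxz : G.Reachable x z)
    (hn : n ≤ G.dist x z) : ∃ y, G.dist x y = n ∧ G.dist y z = G.dist x z - n := by
  obtain ⟨p, hp⟩ := hxz.exists_walk_length_eq_dist
  refine ⟨p.getVert n, ?_, ?_⟩
  · rw [← SimpleGraph.length_eq_dist_of_subwalk hp (p.isSubwalk_take n), p.take_length, hp,
      min_eq_left hn]
  · rw [← SimpleGraph.length_eq_dist_of_subwalk hp (p.isSubwalk_drop n), p.drop_length, hp]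

lemma finite_setOf_dist_le (hG : G.Connected) (hfin : ∀ x, (G.neighborSet x).Finite) (x : V)
    (n : ℕ) : {y | G.dist x y ≤ n}.Finite := by
  induction n with
  | zero => simp [hG.dist_eq_zero_iff]
  | succ n ih =>
    refine (ih.union (ih.biUnion fun z _ ↦ hfin z)).subset fun y (hy : G.dist x y ≤ n + 1) ↦ ?_
    rcases hy.lt_or_eq with hlt | heq
    · exact Or.inl (Nat.lt_succ_iff.1 hlt)
    · obtain ⟨z, hxz, hzy⟩ := exists_dist_eq_and_dist_eq_sub (n := n) (hG x y) (by omega)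
      have hadj : G.Adj z y := SimpleGraph.dist_eq_one_iff_adj.1 (by omega)
      exact Or.inr (Set.mem_biUnion (show z ∈ {y | G.dist x y ≤ n} from hxz.le) hadj)

lemma exists_dist_eq [Infinite V] (hG : G.Connected) (hfin : ∀ x, (G.neighborSet x).Finite)
    (x : V) (n : ℕ) : ∃ z, G.dist x z = n := by
  obtain ⟨w, hw⟩ := (finite_setOf_dist_le hG hfin x n).exists_notMem
  obtain ⟨z, hz, -⟩ := exists_dist_eq_and_dist_eq_sub (hG x w) (not_le.1 hw).le
  exact ⟨z, hz⟩

lemma dist_cast_triangle (hG : G.Connected) (x y z : V) :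
    (G.dist x z : ℝ) ≤ G.dist x y + G.dist y z :=
  mod_cast hG.dist_triangle

end Distance

variable {V : Type*} {Γ : WeightedGraph V}

section Ball

lemma finite_ball (hconn : Γ.graph.Connected) (hfin : ∀ x, (Γ.graph.neighborSet x).Finite)
    (x : V) (R : ℝ) : (Γ.ball x R).Finite :=
  (finite_setOf_dist_le hconn hfin x ⌈R⌉₊).subset fun _ hy ↦
    Nat.cast_le.1 ((hy : _ < R).le.trans (Nat.le_ceil R))

lemma mem_ball_self (x : V) {R : ℝ} (hR : 0 < R) : x ∈ Γ.ball x R := by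
  simpa [ball] using hR

lemma ball_mono (x : V) {r R : ℝ} (h : r ≤ R) : Γ.ball x r ⊆ Γ.ball x R :=
  fun _ hy ↦ lt_of_lt_of_le hy h

lemma ball_subset_ball (hconn : Γ.graph.Connected) {x y : V} {r R : ℝ}
    (h : Γ.graph.dist x y + r ≤ R) : Γ.ball y r ⊆ Γ.ball x R := fun z hz ↦
  calc (Γ.graph.dist x z : ℝ) ≤ Γ.graph.dist x y + Γ.graph.dist y z :=
        dist_cast_triangle hconn x y z
    _ < Γ.graph.dist x y + r := by gcongr; exact hz
    _ ≤ R := h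

lemma disjoint_ball (hconn : Γ.graph.Connected) {x y : V} {r s : ℝ}
    (h : r + s ≤ Γ.graph.dist x y) : Disjoint (Γ.ball x r) (Γ.ball y s) := by
  refine Set.disjoint_left.2 fun z hx hy ↦ h.not_gt ?_
  calc (Γ.graph.dist x y : ℝ) ≤ Γ.graph.dist x z + Γ.graph.dist y z := by
        rw [Γ.graph.dist_comm (u := y)]
        exact dist_cast_triangle hconn x z y
    _ < r + s := add_lt_add hx hy

lemma disjoint_ball_compl_ball (x : V) {r R : ℝ} (h : r ≤ R) :
    Disjoint (Γ.ball x r) (Γ.ball x R)ᶜ :=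
  Set.disjoint_compl_right_iff_subset.2 (ball_mono x h)

lemma ball_eq_singleton (hconn : Γ.graph.Connected) (x : V) {R : ℝ} (h0 : 0 < R) (h1 : R ≤ 1) :
    Γ.ball x R = {x} := by
  refine (Set.singleton_subset_iff.2 (mem_ball_self x h0)).antisymm' fun y hy ↦ ?_
  have hlt : Γ.graph.dist x y < 1 := by exact_mod_cast lt_of_lt_of_le hy h1
  exact (hconn.dist_eq_zero_iff.1 (Nat.lt_one_iff.1 hlt)).symm

lemma closure_ball_subset (hconn : Γ.graph.Connected) (x : V) (R : ℝ) :
    Γ.closure (Γ.ball x R) ⊆ Γ.ball x (R + 1) := by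
  rintro z (hz | ⟨y, hy, hyz⟩)
  · exact ball_mono x (by linarith) hz
  · calc (Γ.graph.dist x z : ℝ) ≤ Γ.graph.dist x y + Γ.graph.dist y z :=
          dist_cast_triangle hconn x y z
      _ < R + 1 := by
          rw [SimpleGraph.dist_eq_one_iff_adj.2 hyz, Nat.cast_one]
          gcongr
          exact hy

/-- A maximal `R`-separated subset of `B` is an `R`-net of `B`. -/
lemma exists_separated_net (Γ : WeightedGraph V) {B : Set V} (hB : B.Finite) {R : ℝ}
    (hR : 0 < R) :
    ∃ Y : Finset V, ↑Y ⊆ B ∧ (Y : Set V).Pairwise (fun y z ↦ R ≤ Γ.graph.dist y z) ∧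
      B ⊆ ⋃ y ∈ Y, Γ.ball y R := by
  let near : SetRel V V := {p | (Γ.graph.dist p.1 p.2 : ℝ) < R}
  have : near.IsRefl := ⟨fun x ↦ by simpa [near] using hR⟩
  have : near.IsSymm := ⟨fun x y h ↦ by simpa [near, Γ.graph.dist_comm (u := y)] using h⟩
  have hfin : {N : Set V | N ⊆ B ∧ SetRel.IsSeparated near N}.Finite :=
    hB.finite_subsets.subset fun N hN ↦ hN.1
  obtain ⟨N, hN⟩ := hfin.exists_maximal ⟨∅, by simp⟩
  lift N to Finset V using hB.subset hN.1.1
  refine ⟨N, hN.1.1, hN.1.2.imp fun _ _ h ↦ not_lt.1 h, fun x hx ↦ ?_⟩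
  obtain ⟨y, hy, hxy⟩ := SetRel.IsCover.of_maximal_isSeparated hN hx
  exact Set.mem_biUnion hy (by simpa [ball, near, Γ.graph.dist_comm (u := y)] using hxy)

end Ball

section Weight

lemma weight_nonneg (x y : V) : 0 ≤ Γ.weight x y := by
  by_cases h : Γ.graph.Adj x y
  · exact (Γ.weight_pos x y h).le
  · exact (Γ.weight_eq_zero x y h).ge

lemma weight_le_vertexMeasure (x y : V) : Γ.weight x y ≤ Γ.vertexMeasure x :=
  (Γ.weight_summable x).le_tsum y fun z _ ↦ weight_nonneg x z

lemma vertexMeasure_nonneg (x : V) : 0 ≤ Γ.vertexMeasure x :=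
  tsum_nonneg (weight_nonneg x)

lemma CondP0.finite_neighborSet (hp0 : Γ.CondP0) (x : V) :
    (Γ.graph.neighborSet x).Finite := by
  obtain ⟨p, hp, hle⟩ := hp0
  rcases (Γ.graph.neighborSet x).eq_empty_or_nonempty with hempty | ⟨z, hz⟩
  · exact hempty ▸ Set.finite_empty
  have hμ : 0 < Γ.vertexMeasure x := (Γ.weight_pos x z hz).trans_le (weight_le_vertexMeasure x z)
  have hsmall : ∀ᶠ y in Filter.cofinite, Γ.weight x y < p * Γ.vertexMeasure x :=
    (Γ.weight_summable x).tendsto_cofinite_zero.eventually_lt_const (mul_pos hp hμ)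
  exact (Filter.eventually_cofinite.1 hsmall).subset fun y hy ↦
    not_lt.2 ((le_div_iff₀ hμ).1 (hle x y hy))

end Weight

/-! ### Volumes -/

section Volume

lemma setMeasure_nonneg (A : Set V) : 0 ≤ Γ.setMeasure A :=
  tsum_nonneg fun y ↦ vertexMeasure_nonneg y.1

lemma setMeasure_mono {A B : Set V} (hB : B.Finite) (h : A ⊆ B) :
    Γ.setMeasure A ≤ Γ.setMeasure B :=
  Summable.tsum_le_tsum_of_inj (Set.inclusion h) (Set.inclusion_injective h)
    (fun y _ ↦ vertexMeasure_nonneg y.1) (fun _ ↦ le_rfl)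
    ((hB.subset h).summable Γ.vertexMeasure) (hB.summable Γ.vertexMeasure)

lemma sum_setMeasure_le {ι : Type*} {s : Finset ι} {A : ι → Set V} {B : Set V} (hB : B.Finite)
    (hA : ∀ i ∈ s, A i ⊆ B) (hd : (s : Set ι).PairwiseDisjoint A) :
    ∑ i ∈ s, Γ.setMeasure (A i) ≤ Γ.setMeasure B :=
  calc ∑ i ∈ s, Γ.setMeasure (A i) = Γ.setMeasure (⋃ i ∈ s, A i) :=
        (Summable.tsum_finset_bUnion_disjoint hd fun i hi ↦ (hB.subset (hA i hi)).summable _).symm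
    _ ≤ Γ.setMeasure B := setMeasure_mono hB (Set.iUnion₂_subset hA)

lemma setMeasure_add_le {A A' B : Set V} (hB : B.Finite) (hA : A ⊆ B) (hA' : A' ⊆ B)
    (hd : Disjoint A A') : Γ.setMeasure A + Γ.setMeasure A' ≤ Γ.setMeasure B :=
  calc Γ.setMeasure A + Γ.setMeasure A' = Γ.setMeasure (A ∪ A') :=
        (Summable.tsum_union_disjoint hd ((hB.subset hA).summable _)
          ((hB.subset hA').summable _)).symm
    _ ≤ Γ.setMeasure B := setMeasure_mono hB (Set.union_subset hA hA')

lemma annulusVolume_nonneg (hball : ∀ x R, (Γ.ball x R).Finite) (x : V) {r R : ℝ} (h : r ≤ R) :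
    0 ≤ Γ.annulusVolume x r R :=
  sub_nonneg.2 (setMeasure_mono (hball x R) (ball_mono x h))

/-- `D` is a constant for which the volume doubling condition `(VD)` holds. -/
def IsDoublingConstant (Γ : WeightedGraph V) (D : ℝ) : Prop :=
  0 < D ∧ ∀ (x : V) (R : ℝ), 0 < R → Γ.volume x (2 * R) ≤ D * Γ.volume x R

lemma IsDoublingConstant.volume_two_pow_mul_le {D : ℝ} (hD : Γ.IsDoublingConstant D) (x : V)
    {R : ℝ} (hR : 0 < R) (n : ℕ) : Γ.volume x (2 ^ n * R) ≤ D ^ n * Γ.volume x R := by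
  obtain ⟨hD0, hD⟩ := hD
  induction n with
  | zero => simp
  | succ n ih =>
    calc Γ.volume x (2 ^ (n + 1) * R) = Γ.volume x (2 * (2 ^ n * R)) := by ring_nf
      _ ≤ D * Γ.volume x (2 ^ n * R) := hD x _ (by positivity)
      _ ≤ D * (D ^ n * Γ.volume x R) := by gcongr
      _ = D ^ (n + 1) * Γ.volume x R := by ring

/-- The annulus contains a ball of radius `T / 4`, centred at distance about `3T / 2` from `x`. -/
lemma IsDoublingConstant.volume_le_annulusVolume [Infinite V] (hconn : Γ.graph.Connected)
    (hfin : ∀ x, (Γ.graph.neighborSet x).Finite) {D : ℝ} (hD : Γ.IsDoublingConstant D)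
    (x : V) {T : ℝ} (hT : 4 ≤ T) :
    Γ.volume x (2 * T) ≤ D ^ 4 * Γ.annulusVolume x T (2 * T) := by
  have hball := finite_ball hconn hfin
  obtain ⟨z, hz⟩ := exists_dist_eq hconn hfin x ⌈3 * T / 2⌉₊
  have hz_ge : 3 * T / 2 ≤ Γ.graph.dist x z := hz ▸ Nat.le_ceil _
  have hz_lt : (Γ.graph.dist x z : ℝ) < 3 * T / 2 + 1 :=
    hz ▸ Nat.ceil_lt_add_one (by positivity)
  have hdisj : Γ.volume x T + Γ.volume z (T / 4) ≤ Γ.volume x (2 * T) :=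
    setMeasure_add_le (hball _ _) (ball_mono x (by linarith))
      (ball_subset_ball hconn (by linarith)) (disjoint_ball hconn (by linarith))
  calc Γ.volume x (2 * T) ≤ Γ.volume z (2 ^ 4 * (T / 4)) :=
        setMeasure_mono (hball _ _)
          (ball_subset_ball hconn (by rw [SimpleGraph.dist_comm]; linarith))
    _ ≤ D ^ 4 * Γ.volume z (T / 4) := hD.volume_two_pow_mul_le z (by linarith) 4
    _ ≤ D ^ 4 * Γ.annulusVolume x T (2 * T) := by
        have := hD.1
        unfold annulusVolume
        gcongr
        linarith

end Volume

/-! ### The Dirichlet energy -/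

section Energy

variable {f g h : V → ℝ}

/-- The Dirichlet energy `(-Δf, f)_μ`. -/
noncomputable def energy (Γ : WeightedGraph V) (f : V → ℝ) : ℝ :=
  Γ.innerMu (fun x ↦ -Γ.laplacian f x) f

lemma vertexMeasure_mul_transition (x y : V) :
    Γ.vertexMeasure x * Γ.transition x y = Γ.weight x y :=
  mul_div_cancel_of_imp' fun hμ ↦
    le_antisymm (hμ ▸ weight_le_vertexMeasure x y) (weight_nonneg x y)

lemma hasSum_weight_mul_sub (hf : f.support.Finite) (x : V) :
    HasSum (fun y ↦ Γ.weight x y * (f x - f y)) (-Γ.laplacian f x * Γ.vertexMeasure x) := by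
  have hμ : HasSum (fun y ↦ Γ.weight x y * f x) (Γ.vertexMeasure x * f x) :=
    (Γ.weight_summable x).hasSum.mul_right _
  have hP : HasSum (fun y ↦ Γ.vertexMeasure x * (Γ.transition x y * f y))
      (Γ.vertexMeasure x * Γ.markov f x) :=
    (summable_of_hasFiniteSupport
      (hf.subset (Function.support_mul_subset_right _ f))).hasSum.mul_left _
  have hlap : -Γ.laplacian f x * Γ.vertexMeasure x =
      Γ.vertexMeasure x * f x - Γ.vertexMeasure x * Γ.markov f x := by
    unfold laplacian
    ring
  rw [hlap]
  refine (hμ.sub hP).congr_fun fun y ↦ ?_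
  rw [← mul_assoc, vertexMeasure_mul_transition, mul_sub]

lemma hasSum_weight_mul_sub_mul (hf : f.support.Finite) :
    HasSum (fun p : V × V ↦ Γ.weight p.1 p.2 * (f p.1 - f p.2) * f p.1) (Γ.energy f) := by
  have hrow (x : V) : HasSum (fun y ↦ Γ.weight x y * (f x - f y) * f x)
      (-Γ.laplacian f x * f x * Γ.vertexMeasure x) := by
    rw [mul_right_comm]
    exact (hasSum_weight_mul_sub hf x).mul_right (f x)
  have hsum : Summable fun p : V × V ↦ Γ.weight p.1 p.2 * (f p.1 - f p.2) * f p.1 := by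
    refine .of_abs ((summable_prod_of_nonneg fun _ ↦ abs_nonneg _).2
      ⟨fun x ↦ (hrow x).summable.abs, summable_of_hasFiniteSupport (hf.subset fun x hx ↦ ?_)⟩)
    contrapose! hx
    simp [Function.notMem_support.1 hx]
  have hval : ∑' p : V × V, Γ.weight p.1 p.2 * (f p.1 - f p.2) * f p.1 = Γ.energy f :=
    (hsum.hasSum.prod_fiberwise hrow).tsum_eq.symm
  exact hval ▸ hsum.hasSum

lemma hasSum_energy (hf : f.support.Finite) :
    HasSum (fun p : V × V ↦ Γ.weight p.1 p.2 * (f p.1 - f p.2) ^ 2) (2 * Γ.energy f) := by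
  have hsum := hasSum_weight_mul_sub_mul (Γ := Γ) hf
  rw [two_mul]
  refine (hsum.add ((Equiv.prodComm V V).hasSum_iff.2 hsum)).congr_fun fun ⟨x, y⟩ ↦ ?_
  simp only [Function.comp_apply, Equiv.prodComm_apply, Prod.swap_prod_mk, Γ.weight_symm y x]
  ring

lemma weight_mul_sub_sq_nonneg (f : V → ℝ) (x y : V) : 0 ≤ Γ.weight x y * (f x - f y) ^ 2 :=
  mul_nonneg (weight_nonneg x y) (sq_nonneg _)

lemma energy_nonneg (hf : f.support.Finite) : 0 ≤ Γ.energy f := by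
  have htwice : 0 ≤ 2 * Γ.energy f := by
    refine HasSum.nonneg (fun p ↦ ?_) (hasSum_energy hf)
    exact weight_mul_sub_sq_nonneg f p.1 p.2
  linarith

lemma energy_le_add_of_abs_sub_le_max (hf : f.support.Finite) (hg : g.support.Finite)
    (hh : h.support.Finite) (hle : ∀ x y, |h x - h y| ≤ max |f x - f y| |g x - g y|) :
    Γ.energy h ≤ Γ.energy f + Γ.energy g := by
  have hsq (x y : V) : (h x - h y) ^ 2 ≤ (f x - f y) ^ 2 + (g x - g y) ^ 2 := by
    rcases le_max_iff.1 (hle x y) with hxy | hxy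
    · exact (sq_le_sq.2 hxy).trans (le_add_of_nonneg_right (sq_nonneg _))
    · exact (sq_le_sq.2 hxy).trans (le_add_of_nonneg_left (sq_nonneg _))
  have htwice : 2 * Γ.energy h ≤ 2 * Γ.energy f + 2 * Γ.energy g := by
    refine hasSum_le (fun p ↦ ?_) (hasSum_energy hh) ((hasSum_energy hf).add (hasSum_energy hg))
    rw [← mul_add]
    exact mul_le_mul_of_nonneg_left (hsq p.1 p.2) (weight_nonneg p.1 p.2)
  linarith

lemma finite_support_sum_mul {ι : Type*} {s : Finset ι} (c : ι → ℝ) {f : ι → V → ℝ}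
    (hf : ∀ i ∈ s, (f i).support.Finite) : (fun x ↦ ∑ i ∈ s, c i * f i x).support.Finite := by
  refine (s.finite_toSet.biUnion hf).subset fun x hx ↦ ?_
  obtain ⟨i, hi, hix⟩ := Finset.exists_ne_zero_of_sum_ne_zero hx
  exact Set.mem_biUnion hi (right_ne_zero_of_mul hix)

/-- If no edge sees a jump of two of the `f i`, then the `f i` are orthogonal for the energy. -/
lemma energy_sum_mul {ι : Type*} {s : Finset ι} (c : ι → ℝ) {f : ι → V → ℝ}
    (hf : ∀ i ∈ s, (f i).support.Finite)
    (hd : ∀ i ∈ s, ∀ j ∈ s, i ≠ j → ∀ x y, Γ.graph.Adj x y → f i x = f i y ∨ f j x = f j y) :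
    Γ.energy (fun x ↦ ∑ i ∈ s, c i * f i x) = ∑ i ∈ s, c i ^ 2 * Γ.energy (f i) := by
  have hsq (x y : V) (hxy : Γ.graph.Adj x y) :
      (∑ i ∈ s, c i * f i x - ∑ i ∈ s, c i * f i y) ^ 2 =
        ∑ i ∈ s, c i ^ 2 * (f i x - f i y) ^ 2 := by
    simp only [← Finset.sum_sub_distrib, ← mul_sub]
    rw [sq, Finset.sum_mul_sum]
    refine Finset.sum_congr rfl fun i hi ↦ ?_
    rw [Finset.sum_eq_single_of_mem i hi, ← sq, mul_pow]
    intro j hj hji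
    rcases hd i hi j hj hji.symm x y hxy with h | h <;> simp [h]
  have hsum := hasSum_sum fun i hi ↦ (hasSum_energy (Γ := Γ) (hf i hi)).mul_left (c i ^ 2)
  have key : 2 * Γ.energy (fun x ↦ ∑ i ∈ s, c i * f i x) =
      ∑ i ∈ s, c i ^ 2 * (2 * Γ.energy (f i)) := by
    refine (hasSum_energy (finite_support_sum_mul c hf)).unique (hsum.congr_fun fun p ↦ ?_)
    by_cases hp : Γ.graph.Adj p.1 p.2
    · simp only [hsq p.1 p.2 hp, Finset.mul_sum, mul_left_comm]
    · simp [Γ.weight_eq_zero _ _ hp]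
  simp only [mul_left_comm _ (2 : ℝ), ← Finset.mul_sum] at key
  linarith

lemma exists_sq_sub_le_mul_energy {x z : V} (p : Γ.graph.Walk x z) :
    ∃ K : ℝ, 0 < K ∧ ∀ f : V → ℝ, f.support.Finite → (f x - f z) ^ 2 ≤ K * Γ.energy f := by
  induction p with
  | nil => exact ⟨1, one_pos, fun f hf ↦ by simpa using energy_nonneg hf⟩
  | @cons x y z hxy _ ih =>
    obtain ⟨K, hK, hq⟩ := ih
    have hw := Γ.weight_pos x y hxy
    refine ⟨4 / Γ.weight x y + 2 * K, by positivity, fun f hf ↦ ?_⟩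
    have hedge : (f x - f y) ^ 2 ≤ 2 * Γ.energy f / Γ.weight x y :=
      (le_div_iff₀' hw).2 <| le_hasSum (hasSum_energy hf) (x, y) fun p _ ↦
        weight_mul_sub_sq_nonneg f p.1 p.2
    calc (f x - f z) ^ 2 = ((f x - f y) + (f y - f z)) ^ 2 := by ring
      _ ≤ 2 * ((f x - f y) ^ 2 + (f y - f z) ^ 2) := add_sq_le
      _ ≤ 2 * (2 * Γ.energy f / Γ.weight x y + K * Γ.energy f) := by
          gcongr
          exact hq f hf
      _ = (4 / Γ.weight x y + 2 * K) * Γ.energy f := by ring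

end Energy

/-! ### Capacity and resistance -/

section Capacity

variable {A A' B B' : Set V} {f g : V → ℝ}

/-- A finitely supported function which is `1` on `A` and `0` on `B`: a competitor in the
variational problem defining the resistance between `A` and `B`. -/
structure IsCutoff (A B : Set V) (f : V → ℝ) : Prop where
  finite_support : f.support.Finite
  eq_one : ∀ x ∈ A, f x = 1
  eq_zero : ∀ x ∈ B, f x = 0

/-- The capacity between `A` and `B`, the least Dirichlet energy of a cutoff function. It is the
inverse of the resistance, and takes the junk value `0` if there is no cutoff function. -/
noncomputable def capacity (Γ : WeightedGraph V) (A B : Set V) : ℝ :=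
  sInf (Γ.energy '' {f | IsCutoff A B f})

lemma resistance_eq_inv_capacity (A B : Set V) : Γ.resistance A B = (Γ.capacity A B)⁻¹ := by
  refine congrArg (fun s ↦ (sInf s)⁻¹) (Set.ext fun e ↦ ⟨?_, ?_⟩)
  · rintro ⟨f, hf, h1, h0, rfl⟩
    exact ⟨f, ⟨hf, h1, h0⟩, rfl⟩
  · rintro ⟨f, ⟨hf, h1, h0⟩, rfl⟩
    exact ⟨f, hf, h1, h0, rfl⟩

lemma IsCutoff.mono (hf : IsCutoff A B f) (hA : A' ⊆ A) (hB : B' ⊆ B) : IsCutoff A' B' f :=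
  ⟨hf.finite_support, fun x hx ↦ hf.eq_one x (hA hx), fun x hx ↦ hf.eq_zero x (hB hx)⟩

lemma isCutoff_indicator_one (hA : A.Finite) (hAB : Disjoint A B) :
    IsCutoff A B (A.indicator 1) where
  finite_support := hA.subset Set.support_indicator_subset
  eq_one _ hx := Set.indicator_of_mem hx 1
  eq_zero _ hx := Set.indicator_of_notMem (hAB.notMem_of_mem_right hx) 1

lemma IsCutoff.min_one_max (hf : IsCutoff A B f) (hg : IsCutoff A' B g) :
    IsCutoff (A ∪ A') B (fun x ↦ min 1 (max (f x) (g x))) where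
  finite_support := by
    refine (hf.finite_support.union hg.finite_support).subset fun x hx ↦ ?_
    contrapose! hx
    simp only [Set.mem_union, Function.mem_support, not_or, not_not] at hx
    simp [hx]
  eq_one := by
    rintro x (hx | hx)
    · simp [hf.eq_one x hx]
    · simp [hg.eq_one x hx]
  eq_zero x hx := by simp [hf.eq_zero x hx, hg.eq_zero x hx]

lemma IsCutoff.sum_mul {ι : Type*} {s : Finset ι} {c : ι → ℝ} {f : ι → V → ℝ}
    (hf : ∀ i ∈ s, IsCutoff A B (f i)) (hc : ∑ i ∈ s, c i = 1) :
    IsCutoff A B (fun x ↦ ∑ i ∈ s, c i * f i x) where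
  finite_support := finite_support_sum_mul c fun i hi ↦ (hf i hi).finite_support
  eq_one x hx := by
    rw [← hc]
    exact Finset.sum_congr rfl fun i hi ↦ by rw [(hf i hi).eq_one x hx, mul_one]
  eq_zero x hx := Finset.sum_eq_zero fun i hi ↦ by rw [(hf i hi).eq_zero x hx, mul_zero]

lemma IsCutoff.eq_or_eq (hf : IsCutoff A B f) (hg : IsCutoff A' B' g)
    (h : Γ.closure Bᶜ ⊆ A') {x y : V} (hxy : Γ.graph.Adj x y) : f x = f y ∨ g x = g y := by
  by_cases hx : x ∈ B
  · by_cases hy : y ∈ B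
    · exact Or.inl ((hf.eq_zero x hx).trans (hf.eq_zero y hy).symm)
    · exact Or.inr ((hg.eq_one x (h (Or.inr ⟨y, hy, hxy.symm⟩))).trans
        (hg.eq_one y (h (Or.inl hy))).symm)
  · exact Or.inr ((hg.eq_one x (h (Or.inl hx))).trans
      (hg.eq_one y (h (Or.inr ⟨x, hx, hxy⟩))).symm)

lemma capacity_nonneg (A B : Set V) : 0 ≤ Γ.capacity A B :=
  Real.sInf_nonneg (Set.forall_mem_image.2 fun _ hf ↦ energy_nonneg hf.finite_support)

lemma resistance_nonneg (A B : Set V) : 0 ≤ Γ.resistance A B := by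
  rw [resistance_eq_inv_capacity]
  exact inv_nonneg.2 (capacity_nonneg A B)

lemma IsCutoff.capacity_le (hf : IsCutoff A B f) : Γ.capacity A B ≤ Γ.energy f :=
  csInf_le ⟨0, Set.forall_mem_image.2 fun _ hf ↦ energy_nonneg hf.finite_support⟩
    (Set.mem_image_of_mem _ hf)

lemma le_capacity (hA : A.Finite) (hAB : Disjoint A B) {e : ℝ}
    (he : ∀ f, IsCutoff A B f → e ≤ Γ.energy f) : e ≤ Γ.capacity A B :=
  le_csInf ⟨_, Set.mem_image_of_mem _ (isCutoff_indicator_one hA hAB)⟩ (Set.forall_mem_image.2 he)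

lemma exists_isCutoff_energy_lt (hA : A.Finite) (hAB : Disjoint A B) {e : ℝ}
    (he : Γ.capacity A B < e) : ∃ f, IsCutoff A B f ∧ Γ.energy f < e := by
  contrapose! he
  exact le_capacity hA hAB he

lemma capacity_mono (hA : A.Finite) (hAB : Disjoint A B) (hA' : A' ⊆ A) (hB' : B' ⊆ B) :
    Γ.capacity A' B' ≤ Γ.capacity A B :=
  le_capacity hA hAB fun _ hf ↦ (hf.mono hA' hB').capacity_le

lemma capacity_empty_left (B : Set V) : Γ.capacity ∅ B = 0 := by
  have hzero : IsCutoff ∅ B (0 : V → ℝ) := ⟨by simp, by simp, by simp⟩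
  exact (hzero.capacity_le.trans_eq (by simp [energy, innerMu])).antisymm (capacity_nonneg ∅ B)

lemma capacity_union_le (hA : A.Finite) (hA' : A'.Finite) (hAB : Disjoint A B)
    (hAB' : Disjoint A' B) :
    Γ.capacity (A ∪ A') B ≤ Γ.capacity A B + Γ.capacity A' B := by
  refine le_add_of_forall_lt fun e he e' he' ↦ ?_
  obtain ⟨f, hf, hfe⟩ := exists_isCutoff_energy_lt hA hAB he
  obtain ⟨g, hg, hge⟩ := exists_isCutoff_energy_lt hA' hAB' he'
  have hfg := hf.min_one_max hg
  calc Γ.capacity (A ∪ A') B ≤ Γ.energy (fun x ↦ min 1 (max (f x) (g x))) := hfg.capacity_le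
    _ ≤ Γ.energy f + Γ.energy g :=
        energy_le_add_of_abs_sub_le_max hf.finite_support hg.finite_support hfg.finite_support
          fun x y ↦ (abs_min_sub_min_le_max _ _ _ _).trans
            (max_le (by simp) (abs_max_sub_max_le_max _ _ _ _))
    _ ≤ e + e' := by gcongr

lemma capacity_biUnion_le {ι : Type*} {s : Finset ι} {A : ι → Set V}
    (hA : ∀ i ∈ s, (A i).Finite) (hAB : ∀ i ∈ s, Disjoint (A i) B) :
    Γ.capacity (⋃ i ∈ s, A i) B ≤ ∑ i ∈ s, Γ.capacity (A i) B := by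
  classical
  induction s using Finset.induction_on with
  | empty => simp [capacity_empty_left]
  | insert i s hi ih =>
    rw [Finset.forall_mem_insert] at hA hAB
    rw [Finset.set_biUnion_insert, Finset.sum_insert hi]
    exact (capacity_union_le hA.1 (s.finite_toSet.biUnion hA.2) hAB.1
      (Set.disjoint_iUnion₂_left.2 hAB.2)).trans (by gcongr; exact ih hA.2 hAB.2)

lemma capacity_pos (hA : A.Finite) (hAB : Disjoint A B) {x z : V} (hx : x ∈ A) (hz : z ∈ B)
    (hxz : Γ.graph.Reachable x z) : 0 < Γ.capacity A B := by
  obtain ⟨p⟩ := hxz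
  obtain ⟨K, hK, hle⟩ := exists_sq_sub_le_mul_energy p
  refine (inv_pos.2 hK).trans_le (le_capacity hA hAB fun f hf ↦ ?_)
  have hone := hle f hf.finite_support
  rw [hf.eq_one x hx, hf.eq_zero z hz, sub_zero, one_pow] at hone
  exact (inv_le_iff_one_le_mul₀' hK).2 hone

variable {ι : Type*} [LinearOrder ι] {s : Finset ι} {A₀ B₀ : Set V} {A B : ι → Set V}

lemma capacity_le_sum_sq_mul_capacity (hA : ∀ i ∈ s, (A i).Finite)
    (hAB : ∀ i ∈ s, Disjoint (A i) (B i)) (hA₀ : ∀ i ∈ s, A₀ ⊆ A i) (hB₀ : ∀ i ∈ s, B₀ ⊆ B i)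
    (hsep : ∀ i ∈ s, ∀ j ∈ s, i < j → Γ.closure (B i)ᶜ ⊆ A j) {c : ι → ℝ}
    (hc : ∑ i ∈ s, c i = 1) :
    Γ.capacity A₀ B₀ ≤ ∑ i ∈ s, c i ^ 2 * Γ.capacity (A i) (B i) := by
  have happrox (ε : ℝ) (hε : 0 < ε) :
      Γ.capacity A₀ B₀ ≤ ∑ i ∈ s, c i ^ 2 * (Γ.capacity (A i) (B i) + ε) := by
    choose! f hf hlt using fun i hi ↦
      exists_isCutoff_energy_lt (hA i hi) (hAB i hi) (lt_add_of_pos_right _ hε)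
    have horth : ∀ i ∈ s, ∀ j ∈ s, i ≠ j → ∀ x y, Γ.graph.Adj x y →
        f i x = f i y ∨ f j x = f j y := by
      intro i hi j hj hij x y hxy
      rcases hij.lt_or_gt with h | h
      · exact (hf i hi).eq_or_eq (hf j hj) (hsep i hi j hj h) hxy
      · exact ((hf j hj).eq_or_eq (hf i hi) (hsep j hj i hi h) hxy).symm
    calc Γ.capacity A₀ B₀ ≤ Γ.energy (fun x ↦ ∑ i ∈ s, c i * f i x) :=
          (IsCutoff.sum_mul (fun i hi ↦ (hf i hi).mono (hA₀ i hi) (hB₀ i hi)) hc).capacity_le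
      _ = ∑ i ∈ s, c i ^ 2 * Γ.energy (f i) :=
          energy_sum_mul c (fun i hi ↦ (hf i hi).finite_support) horth
      _ ≤ ∑ i ∈ s, c i ^ 2 * (Γ.capacity (A i) (B i) + ε) := by
          gcongr with i hi
          exact (hlt i hi).le
  have hcont : Continuous fun ε ↦ ∑ i ∈ s, c i ^ 2 * (Γ.capacity (A i) (B i) + ε) := by fun_prop
  simpa using ge_of_tendsto (hcont.continuousWithinAt (s := Set.Ioi 0) (x := 0))
    (eventually_mem_nhdsWithin.mono happrox)

/-- Resistances in series: weight the cutoff function of the `i`-th pair by its share of the total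
resistance. -/
lemma sum_resistance_le_resistance (hA : ∀ i ∈ s, (A i).Finite)
    (hAB : ∀ i ∈ s, Disjoint (A i) (B i)) (hA₀ : ∀ i ∈ s, A₀ ⊆ A i) (hB₀ : ∀ i ∈ s, B₀ ⊆ B i)
    (hsep : ∀ i ∈ s, ∀ j ∈ s, i < j → Γ.closure (B i)ᶜ ⊆ A j)
    (hpos : 0 < Γ.capacity A₀ B₀) :
    ∑ i ∈ s, Γ.resistance (A i) (B i) ≤ Γ.resistance A₀ B₀ := by
  simp only [resistance_eq_inv_capacity]
  have hcap (i) (hi : i ∈ s) : 0 < Γ.capacity (A i) (B i) :=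
    hpos.trans_le (capacity_mono (hA i hi) (hAB i hi) (hA₀ i hi) (hB₀ i hi))
  rcases s.eq_empty_or_nonempty with rfl | hs
  · simpa using hpos.le
  set S := ∑ i ∈ s, (Γ.capacity (A i) (B i))⁻¹ with hS
  have hS0 : 0 < S := Finset.sum_pos (fun i hi ↦ inv_pos.2 (hcap i hi)) hs
  refine (le_inv_comm₀ hS0 hpos).2 ?_
  calc Γ.capacity A₀ B₀
      ≤ ∑ i ∈ s, ((Γ.capacity (A i) (B i))⁻¹ / S) ^ 2 * Γ.capacity (A i) (B i) :=
        capacity_le_sum_sq_mul_capacity hA hAB hA₀ hB₀ hsep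
          (by rw [← Finset.sum_div, div_self hS0.ne'])
    _ = ∑ i ∈ s, (Γ.capacity (A i) (B i))⁻¹ / S ^ 2 :=
        Finset.sum_congr rfl fun i hi ↦ by
          have := (hcap i hi).ne'
          field_simp
    _ = S⁻¹ := by
        rw [← Finset.sum_div, ← hS]
        field_simp

end Capacity

/-! ### Annuli -/

section Annulus

lemma rhoV_nonneg (hball : ∀ x R, (Γ.ball x R).Finite) (x : V) {R : ℝ} (hR : 0 ≤ R) :
    0 ≤ Γ.rhoV x R :=
  mul_nonneg (resistance_nonneg _ _) (annulusVolume_nonneg hball x (by linarith))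

lemma rhoV_eq_zero (hconn : Γ.graph.Connected) (x : V) {R : ℝ} (h0 : 0 < R) (h1 : 2 * R ≤ 1) :
    Γ.rhoV x R = 0 := by
  unfold rhoV annulusVolume volume
  rw [ball_eq_singleton hconn x h0 (by linarith), ball_eq_singleton hconn x (by linarith) h1,
    sub_self, mul_zero]

lemma capacity_annulus_pos [Infinite V] (hconn : Γ.graph.Connected)
    (hball : ∀ x R, (Γ.ball x R).Finite) (x : V) {r R : ℝ} (hr : 0 < r) (hrR : r ≤ R) :
    0 < Γ.capacity (Γ.ball x r) (Γ.ball x R)ᶜ := by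
  obtain ⟨z, hz⟩ := (hball x R).exists_notMem
  exact capacity_pos (hball x r) (disjoint_ball_compl_ball x hrR) (mem_ball_self x hr) hz
    (hconn x z)

lemma sum_annulusResistance_le [Infinite V] (hconn : Γ.graph.Connected)
    (hball : ∀ x R, (Γ.ball x R).Finite) (x : V) {ι : Type*} [LinearOrder ι] {s : Finset ι}
    {r R : ι → ℝ} {r₀ R₀ : ℝ} (hr₀ : 0 < r₀) (h₀ : r₀ ≤ R₀) (hr : ∀ i ∈ s, r₀ ≤ r i)
    (hrR : ∀ i ∈ s, r i ≤ R i) (hR : ∀ i ∈ s, R i ≤ R₀)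
    (hsep : ∀ i ∈ s, ∀ j ∈ s, i < j → R i + 1 ≤ r j) :
    ∑ i ∈ s, Γ.annulusResistance x (r i) (R i) ≤ Γ.annulusResistance x r₀ R₀ := by
  refine sum_resistance_le_resistance (fun i _ ↦ hball x (r i))
    (fun i hi ↦ disjoint_ball_compl_ball x (hrR i hi)) (fun i hi ↦ ball_mono x (hr i hi))
    (fun i hi ↦ Set.compl_subset_compl.2 (ball_mono x (hR i hi))) (fun i hi j hj hij ↦ ?_)
    (capacity_annulus_pos hconn hball x hr₀ h₀)
  rw [compl_compl]
  exact (closure_ball_subset hconn x (R i)).trans (ball_mono x (hsep i hi j hj hij))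

lemma rhoV_mul_capacity_le (hball : ∀ x R, (Γ.ball x R).Finite) (x : V) {R : ℝ} (hR : 0 ≤ R) :
    Γ.rhoV x R * Γ.capacity (Γ.ball x R) (Γ.ball x (2 * R))ᶜ ≤ Γ.annulusVolume x R (2 * R) := by
  have hv : 0 ≤ Γ.annulusVolume x R (2 * R) := annulusVolume_nonneg hball x (by linarith)
  rw [rhoV, annulusResistance, resistance_eq_inv_capacity, mul_right_comm]
  exact mul_le_of_le_one_left hv inv_mul_le_one

variable {D m R : ℝ}

lemma IsDoublingConstant.rhoV_mul_capacity_le_volume (hD : Γ.IsDoublingConstant D)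
    (hball : ∀ x R, (Γ.ball x R).Finite) (x : V) (hR : 0 < R) :
    Γ.rhoV x R * Γ.capacity (Γ.ball x R) (Γ.ball x (2 * R))ᶜ ≤ D ^ 2 * Γ.volume x (R / 2) :=
  calc Γ.rhoV x R * Γ.capacity (Γ.ball x R) (Γ.ball x (2 * R))ᶜ
      ≤ Γ.annulusVolume x R (2 * R) := rhoV_mul_capacity_le hball x hR.le
    _ ≤ Γ.volume x (2 * R) := sub_le_self _ (setMeasure_nonneg _)
    _ = Γ.volume x (2 ^ 2 * (R / 2)) := by ring_nf
    _ ≤ D ^ 2 * Γ.volume x (R / 2) := hD.volume_two_pow_mul_le x (half_pos hR) 2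

/-- Cover `B(x,r)` by the balls `B(y,R)` of an `R`-net: the balls `B(y,R/2)` are disjoint. -/
lemma IsDoublingConstant.mul_capacity_shell_le (hD : Γ.IsDoublingConstant D)
    (hconn : Γ.graph.Connected) (hball : ∀ x R, (Γ.ball x R).Finite) (hR : 0 < R) (hm0 : 0 ≤ m)
    (hm : ∀ y, m ≤ Γ.rhoV y R) (x : V) (r : ℝ) :
    m * Γ.capacity (Γ.ball x r) (Γ.ball x (r + 2 * R))ᶜ ≤ D ^ 2 * Γ.volume x (r + 2 * R) := by
  obtain ⟨Y, hYx, hsep, hcov⟩ := exists_separated_net Γ (hball x r) hR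
  set B := (Γ.ball x (r + 2 * R))ᶜ
  have hsub (y) (hy : y ∈ Y) : Γ.ball y (2 * R) ⊆ Γ.ball x (r + 2 * R) :=
    ball_subset_ball hconn (add_le_add_left (hYx hy : _ < r).le _)
  have hdisj (y) (hy : y ∈ Y) : Disjoint (Γ.ball y R) B :=
    Set.disjoint_compl_right_iff_subset.2 ((ball_mono y (by linarith)).trans (hsub y hy))
  have hhalf : (Y : Set V).PairwiseDisjoint fun y ↦ Γ.ball y (R / 2) :=
    hsep.imp fun y z hyz ↦ disjoint_ball hconn (by rwa [add_halves])
  calc m * Γ.capacity (Γ.ball x r) B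
      ≤ m * Γ.capacity (⋃ y ∈ Y, Γ.ball y R) B := by
        gcongr
        exact capacity_mono (Y.finite_toSet.biUnion fun y _ ↦ hball y R)
          (Set.disjoint_iUnion₂_left.2 hdisj) hcov subset_rfl
    _ ≤ m * ∑ y ∈ Y, Γ.capacity (Γ.ball y R) B := by
        gcongr
        exact capacity_biUnion_le (fun y _ ↦ hball y R) hdisj
    _ ≤ ∑ y ∈ Y, Γ.rhoV y R * Γ.capacity (Γ.ball y R) (Γ.ball y (2 * R))ᶜ := by
        rw [Finset.mul_sum]
        gcongr with y hy
        · exact capacity_nonneg _ _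
        · exact rhoV_nonneg hball y hR.le
        · exact hm y
        · exact capacity_mono (hball y R) (disjoint_ball_compl_ball y (by linarith)) subset_rfl
            (Set.compl_subset_compl.2 (hsub y hy))
    _ ≤ ∑ y ∈ Y, D ^ 2 * Γ.volume y (R / 2) :=
        Finset.sum_le_sum fun y _ ↦ hD.rhoV_mul_capacity_le_volume hball y hR
    _ ≤ D ^ 2 * Γ.volume x (r + 2 * R) := by
        rw [← Finset.mul_sum]
        gcongr
        exact sum_setMeasure_le (hball _ _)
          (fun y hy ↦ (ball_mono y (by linarith)).trans (hsub y hy)) hhalf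

lemma IsDoublingConstant.le_mul_annulusResistance_shell [Infinite V]
    (hD : Γ.IsDoublingConstant D) (hconn : Γ.graph.Connected)
    (hball : ∀ x R, (Γ.ball x R).Finite) (hR : 0 < R) (hm0 : 0 ≤ m)
    (hm : ∀ y, m ≤ Γ.rhoV y R) (x : V) {r : ℝ} (hr : 0 < r) :
    m ≤ D ^ 2 * Γ.volume x (r + 2 * R) * Γ.annulusResistance x r (r + 2 * R) := by
  rw [annulusResistance, resistance_eq_inv_capacity, ← div_eq_mul_inv,
    le_div_iff₀ (capacity_annulus_pos hconn hball x hr (by linarith))]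
  exact hD.mul_capacity_shell_le hconn hball hR hm0 hm x r

/-- Put the shells `B(x,T+4Ri+2R) \ B(x,T+4Ri)`, `i < k`, in series. -/
lemma IsDoublingConstant.natCast_mul_le_mul_annulusResistance [Infinite V]
    (hD : Γ.IsDoublingConstant D) (hconn : Γ.graph.Connected)
    (hball : ∀ x R, (Γ.ball x R).Finite) (hR : 1 ≤ 2 * R) (hm0 : 0 ≤ m)
    (hm : ∀ y, m ≤ Γ.rhoV y R) (x : V) {T : ℝ} (hT0 : 0 < T) {k : ℕ} (hT : 4 * R * k ≤ T) :
    k * m ≤ D ^ 2 * Γ.volume x (2 * T) * Γ.annulusResistance x T (2 * T) := by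
  have hR0 : 0 < R := by linarith
  let r (i : ℕ) : ℝ := T + 4 * R * i
  have hr (i : ℕ) : T ≤ r i := le_add_of_nonneg_right (by positivity)
  have hstep {i j : ℕ} (hij : i < j) : 4 * R * (i + 1) ≤ 4 * R * j := by
    gcongr
    exact_mod_cast hij
  have hle (i : ℕ) (hi : i ∈ Finset.range k) : r i + 2 * R ≤ 2 * T := by
    linarith [hstep (Finset.mem_range.1 hi)]
  calc k * m = ∑ _i ∈ Finset.range k, m := by simp
    _ ≤ ∑ i ∈ Finset.range k,
          D ^ 2 * Γ.volume x (2 * T) * Γ.annulusResistance x (r i) (r i + 2 * R) := by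
        gcongr with i hi
        refine (hD.le_mul_annulusResistance_shell hconn hball hR0 hm0 hm x
          (hT0.trans_le (hr i))).trans ?_
        gcongr
        · exact resistance_nonneg _ _
        · exact setMeasure_mono (hball _ _) (ball_mono x (hle i hi))
    _ ≤ D ^ 2 * Γ.volume x (2 * T) * Γ.annulusResistance x T (2 * T) := by
        rw [← Finset.mul_sum]
        gcongr
        · exact mul_nonneg (sq_nonneg D) (setMeasure_nonneg _)
        · exact sum_annulusResistance_le hconn hball x hT0 (by linarith) (fun i _ ↦ hr i)
            (fun i _ ↦ by linarith) hle fun i _ j _ hij ↦ by linarith [hstep hij]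

lemma IsDoublingConstant.natCast_mul_le_mul_rhoV [Infinite V]
    (hD : Γ.IsDoublingConstant D) (hconn : Γ.graph.Connected)
    (hfin : ∀ x, (Γ.graph.neighborSet x).Finite) (hR : 1 ≤ 2 * R) (hm0 : 0 ≤ m)
    (hm : ∀ y, m ≤ Γ.rhoV y R) (x : V) {T : ℝ} (hT4 : 4 ≤ T) {k : ℕ} (hT : 4 * R * k ≤ T) :
    k * m ≤ D ^ 6 * Γ.rhoV x T :=
  calc k * m ≤ D ^ 2 * Γ.volume x (2 * T) * Γ.annulusResistance x T (2 * T) :=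
        hD.natCast_mul_le_mul_annulusResistance hconn (finite_ball hconn hfin) hR hm0 hm x
          (by linarith) hT
    _ ≤ D ^ 2 * (D ^ 4 * Γ.annulusVolume x T (2 * T)) * Γ.annulusResistance x T (2 * T) := by
        gcongr
        · exact resistance_nonneg _ _
        · exact hD.volume_le_annulusVolume hconn hfin x hT4
    _ = D ^ 6 * Γ.rhoV x T := by
        unfold rhoV
        ring

end Annulus

end WeightedGraph

theorem mainTheorem8_general {V : Type*} [Infinite V] (Γ : WeightedGraph V)
    (hconn : Γ.graph.Connected) (hfin : ∀ x, (Γ.graph.neighborSet x).Finite)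
    (hVD : Γ.VolumeDoubling) (hrv : Γ.CondRhoV) :
    ∃ A : ℝ, 1 < A ∧ ∀ (x : V) (R : ℝ), 0 < R →
      2 * (Γ.annulusResistance x R (2 * R) * Γ.annulusVolume x R (2 * R)) ≤
        Γ.annulusResistance x (A * R) (2 * (A * R)) *
          Γ.annulusVolume x (A * R) (2 * (A * R)) := by
  change ∃ A : ℝ, 1 < A ∧ ∀ x R, 0 < R → 2 * Γ.rhoV x R ≤ Γ.rhoV x (A * R)
  obtain ⟨D, hD⟩ : ∃ D, Γ.IsDoublingConstant D := hVD
  obtain ⟨C, hC, hrv⟩ := hrv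
  have hball := WeightedGraph.finite_ball hconn hfin
  have hD0 : 0 < D := hD.1
  obtain ⟨k, hk⟩ := exists_nat_ge (max 2 (2 * C * D ^ 6))
  obtain ⟨hk2, hkC⟩ := max_le_iff.1 hk
  refine ⟨4 * k, by linarith, fun x R hR ↦ ?_⟩
  have hF0 := WeightedGraph.rhoV_nonneg hball x hR.le
  rcases le_or_gt (2 * R) 1 with hR1 | hR1
  · rw [WeightedGraph.rhoV_eq_zero hconn x hR hR1, mul_zero]
    exact WeightedGraph.rhoV_nonneg hball x (by positivity)
  have hmain : k * (C⁻¹ * Γ.rhoV x R) ≤ D ^ 6 * Γ.rhoV x (4 * k * R) :=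
    hD.natCast_mul_le_mul_rhoV hconn hfin hR1.le (by positivity) (fun y ↦ (hrv x y R hR).1) x
      (by nlinarith) (by linarith)
  refine le_of_mul_le_mul_left ?_ (pow_pos hD0 6)
  calc D ^ 6 * (2 * Γ.rhoV x R) = 2 * C * D ^ 6 * (C⁻¹ * Γ.rhoV x R) := by field_simp
    _ ≤ k * (C⁻¹ * Γ.rhoV x R) := by gcongr
    _ ≤ D ^ 6 * Γ.rhoV x (4 * k * R) := hmain

theorem mainTheorem8 {V : Type*} [Countable V] [Infinite V] (Γ : WeightedGraph V)
    (hconn : Γ.graph.Connected) (hp0 : Γ.CondP0) (hVD : Γ.VolumeDoubling)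
    (hH : Γ.EllipticHarnack) (hrv : Γ.CondRhoV) :
    ∃ A : ℝ, 1 < A ∧ ∀ (x : V) (R : ℝ), 0 < R →
      2 * (Γ.annulusResistance x R (2 * R) * Γ.annulusVolume x R (2 * R)) ≤
        Γ.annulusResistance x (A * R) (2 * (A * R)) *
          Γ.annulusVolume x (A * R) (2 * (A * R)) :=
  mainTheorem8_general Γ hconn hp0.finite_neighborSet hVD hrv
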